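/- Let $k \ge 1$ be an integer. A $k$-tree is a finite simple graph obtained recursively: the complete graph $K_k$ is a $k$-tree, and if $G$ is a $k$-tree, then so is every graph obtained from $G$ by adding one new vertex and joining it exactly to the vertices of some $k$-clique of $G$. For $n \ge k$, the $k$-path $P_n^k$ is the graph with vertices $v_1,\dots,v_n$ in which $v_1,\dots,v_k$ form a clique and each $v_i$ with $i>k$ is adjacent, among $v_1,\dots,v_{i-1}$, exactly to $v_{i-1},\dots,v_{i-k}$; the $k$-star $S_{k,n-k}$ is the graph with vertices $v_1,\dots,v_n$ in which $v_1,\dots,v_k$ form a clique and each $v_i$ with $i>k$ is adjacent exactly to $v_1,\dots,v_k$. For a finite simple graph $G$ let $\Pi_2(G)=\prod_{uv\in E(G)} d(u)d(v)$ be its second multiplicative Zagreb index, where $d(v)$ is the degree of $v$. **Theorem 3.** Let $T$ be a $k$-tree on $n \ge k$ vertices. Then $\Pi_2(T)=\prod_{v\in V(T)} d(v)^{d(v)}$ (with $0^0=1$) and $$\Pi_2(P_n^k)\;\le\;\Pi_2(T)\;\le\;\Pi_2(S_{k,n-k}).$$ Equality holds on the left if and only if $T\cong P_n^k$, and on the right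 if and only if $T\cong S_{k,n-k}$. -/

import Mathlib

universe u

/-- `IsKTree k G`: the graph `G` is a `k`-tree (used for `k ≥ 1`). The smallest `k`-tree is the
complete graph on `k` vertices; and if `C` is a `k`-clique of a `k`-tree, then joining one new
vertex `v` exactly to the vertices of `C` gives a `k`-tree. The second rule is phrased from the
side of the larger graph `G`: the vertex `v` has as its neighbourhood a `k`-clique `C`, and
`G - v` is a `k`-tree. -/
inductive IsKTree (k : ℕ) : ∀ {V : Type u}, SimpleGraph V → Prop
  | complete {V : Type u} [Finite V] (hV : Nat.card V = k) :
      IsKTree k (⊤ : SimpleGraph V)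
  | addVertex {V : Type u} (G : SimpleGraph V) (v : V) (C : Finset V)
      (hC : G.IsNClique k C) (hv : G.neighborSet v = (C : Set V))
      (hG : IsKTree k (G.induce ({v}ᶜ : Set V))) :
      IsKTree k G

/-- The `k`-path on `n` vertices `0, …, n - 1`: the first `k` vertices form a clique, and each
later vertex `j` is joined, among the vertices before it, exactly to `j - 1, …, j - k`.
That is, distinct vertices are adjacent iff they differ by at most `k`. -/
def kPath (k n : ℕ) : SimpleGraph (Fin n) where
  Adj i j := i ≠ j ∧ (i : ℕ) ≤ j + k ∧ (j : ℕ) ≤ i + k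
  symm := ⟨fun _ _ h => ⟨h.1.symm, h.2.2, h.2.1⟩⟩
  loopless := ⟨fun _ h => h.1 rfl⟩

instance (k n : ℕ) : DecidableRel (kPath k n).Adj := fun i j =>
  inferInstanceAs (Decidable (i ≠ j ∧ (i : ℕ) ≤ j + k ∧ (j : ℕ) ≤ i + k))

/-- The `k`-star on `n` vertices `0, …, n - 1`: the first `k` vertices form a clique, the other
`n - k` vertices are independent and each of them is joined to all of the first `k`. -/
def kStar (k n : ℕ) : SimpleGraph (Fin n) where
  Adj i j := i ≠ j ∧ ((i : ℕ) < k ∨ (j : ℕ) < k)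
  symm := ⟨fun _ _ h => ⟨h.1.symm, h.2.symm⟩⟩
  loopless := ⟨fun _ h => h.1 rfl⟩

instance (k n : ℕ) : DecidableRel (kStar k n).Adj := fun i j =>
  inferInstanceAs (Decidable (i ≠ j ∧ ((i : ℕ) < k ∨ (j : ℕ) < k)))

/-- The second multiplicative Zagreb index: the product over all edges `uv` of `d(u) * d(v)`. -/
def secondZagreb {V : Type*} [Fintype V] [DecidableEq V] (G : SimpleGraph V)
    [DecidableRel G.Adj] : ℕ :=
  ∏ e ∈ G.edgeFinset,
    Sym2.lift ⟨fun u v => G.degree u * G.degree v, fun _ _ => Nat.mul_comm _ _⟩ e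

open Finset

section KTree

open scoped Classical

/-! ### Deleting a vertex, and induction on `k`-trees. -/

/-- Summing over all vertices, split off one vertex. -/
theorem sum_eq_add_sum_compl_singleton {V M : Type*} [Fintype V] [AddCommMonoid M] (v : V)
    (f : V → M) : ∑ w, f w = f v + ∑ w : ({v}ᶜ : Set V), f w := by
  rw [Fintype.sum_eq_add_sum_subtype_ne f v]
  rfl

theorem card_eq_card_compl_singleton_add_one {V : Type*} [Fintype V] (v : V) :
    Fintype.card V = Fintype.card ({v}ᶜ : Set V) + 1 := by
  have h := sum_eq_add_sum_compl_singleton v (fun _ : V => 1)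
  simp only [sum_const, card_univ, smul_eq_mul, mul_one] at h
  rw [h, add_comm]

theorem degree_eq_degree_induce_compl {V : Type*} [Fintype V] (G : SimpleGraph V) (v : V)
    {H : SimpleGraph ({v}ᶜ : Set V)} (hH : H = G.induce ({v}ᶜ : Set V)) (x : ({v}ᶜ : Set V)) :
    G.degree x = H.degree x + if G.Adj v x then 1 else 0 := by
  have h₁ := G.degree_eq_sum_if_adj (R := ℕ) (x : V)
  have h₂ := H.degree_eq_sum_if_adj (R := ℕ) x
  rw [sum_eq_add_sum_compl_singleton v] at h₁
  simp only [hH, Nat.cast_id, SimpleGraph.comap_adj, Function.Embedding.subtype_apply,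
    SimpleGraph.adj_comm G x v] at h₁ h₂
  rw [h₁, h₂, add_comm]

theorem degree_eq_card_compl {V : Type*} [Fintype V] (G : SimpleGraph V) (v : V)
    (C : Finset ({v}ᶜ : Set V)) (hC : ∀ x, x ∈ C ↔ G.Adj v x) : G.degree v = #C := by
  have h₁ := G.degree_eq_sum_if_adj (R := ℕ) v
  rw [sum_eq_add_sum_compl_singleton v] at h₁
  simp only [SimpleGraph.irrefl, if_false, zero_add, ← hC, Nat.cast_id] at h₁
  rw [h₁]
  simp

theorem IsKTree.finite {k : ℕ} {V : Type u} {G : SimpleGraph V} (hG : IsKTree k G) :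
    Finite V := by
  induction hG with
  | complete hV => assumption
  | addVertex G v C hC hv hG ih =>
    have := (Set.toFinite ({v}ᶜ : Set _)).union (Set.finite_singleton v)
    rw [Set.compl_union_self] at this
    exact Set.finite_univ_iff.1 this

/-- Induction on `k`-trees with the neighbourhood of the last vertex seen in the smaller graph. -/
theorem IsKTree.induct {k : ℕ} {motive : ∀ {V : Type u} [Fintype V], SimpleGraph V → Prop}
    (complete : ∀ {V : Type u} [Fintype V], Fintype.card V = k → motive (⊤ : SimpleGraph V))
    (step : ∀ {V : Type u} [Fintype V] (G : SimpleGraph V) (v : V)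
      (H : SimpleGraph ({v}ᶜ : Set V)) (C : Finset ({v}ᶜ : Set V)),
      H = G.induce ({v}ᶜ : Set V) → (∀ x, x ∈ C ↔ G.Adj v x) → H.IsNClique k C →
      IsKTree k H → motive H → motive G)
    {V : Type u} [Fintype V] {G : SimpleGraph V} (hG : IsKTree k G) : motive G := by
  rename_i hfin
  -- The instance is generalised so that the induction hypothesis applies to the one carried by the
  -- complement of `v`.
  suffices h : ∀ hfin : Fintype V, @motive V hfin G from h hfin
  clear hfin
  induction hG with
  | complete hV => exact fun _ => complete (by rw [← hV, Nat.card_eq_fintype_card])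
  | @addVertex V G v C hC hv hG ih =>
    intro hfin
    have hmem : ∀ x, x ∈ C ↔ G.Adj v x := fun x => by
      rw [← Finset.mem_coe, ← hv, SimpleGraph.mem_neighborSet]
    have hmap : (C.subtype (· ∈ ({v}ᶜ : Set V))).map (Function.Embedding.subtype _) = C := by
      rw [Finset.subtype_map, Finset.filter_true_of_mem]
      intro x hx
      exact ((hmem x).1 hx).ne'
    refine step G v _ (C.subtype (· ∈ ({v}ᶜ : Set V))) rfl (fun x => ?_) ⟨?_, ?_⟩ hG (ih _)
    · rw [Finset.mem_subtype, hmem]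
    · intro x hx y hy hxy
      exact hC.1 (by simpa using hx) (by simpa using hy) (fun h => hxy (Subtype.ext h))
    · rw [← hC.2, ← hmap, Finset.card_map, hmap]

theorem IsKTree.le_card {k : ℕ} {V : Type u} [Fintype V] {G : SimpleGraph V}
    (hG : IsKTree k G) : k ≤ Fintype.card V := by
  refine hG.induct (motive := fun {V} _ _ => k ≤ Fintype.card V) (fun h => h.ge) ?_
  intro V _ G v H C _ _ _ _ ih
  rw [card_eq_card_compl_singleton_add_one v]
  omega

/-! ### Cliques and universal vertices. -/

/-- The part of a finite vertex set avoiding `v`, seen in the complement of `v`, has the size of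
the set with `v` erased. -/
theorem card_subtype_compl_singleton {V : Type*} (v : V) (A : Finset V) :
    #(A.subtype (· ∈ ({v}ᶜ : Set V))) = #(A.erase v) := by
  rw [Finset.card_subtype]
  congr 1
  ext x
  simp [and_comm]

theorem SimpleGraph.IsClique.subtype_compl {V : Type*} {G : SimpleGraph V} {v : V} {A : Finset V}
    (hA : G.IsClique A) :
    (G.induce ({v}ᶜ : Set V)).IsClique (A.subtype (· ∈ ({v}ᶜ : Set V))) := by
  intro x hx y hy hxy
  exact hA (by simpa using hx) (by simpa using hy) (fun h => hxy (Subtype.ext h))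

/-- Every clique through `v` is contained in the closed neighbourhood of `v`. -/
theorem SimpleGraph.IsClique.subtype_compl_subset {V : Type*} {G : SimpleGraph V} {v : V}
    {A : Finset V} (hA : G.IsClique A) (hv : v ∈ A) {C : Finset ({v}ᶜ : Set V)}
    (hC : ∀ x, x ∈ C ↔ G.Adj v x) : A.subtype (· ∈ ({v}ᶜ : Set V)) ⊆ C := by
  intro x hx
  rw [hC]
  rw [Finset.mem_subtype] at hx
  exact hA hv hx (fun h => x.2 h.symm)

/-- A clique through the last vertex lies in that vertex and its `k` neighbours; any other clique
already lies in the smaller tree. -/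
theorem IsKTree.card_clique_le {k : ℕ} {V : Type u} [Fintype V] {G : SimpleGraph V}
    (hG : IsKTree k G) : ∀ A : Finset V, G.IsClique A → #A ≤ k + 1 := by
  refine hG.induct (motive := fun {V} _ G => ∀ A : Finset V, G.IsClique A → #A ≤ k + 1) ?_ ?_
  · intro V _ h A _
    have := A.card_le_univ
    omega
  · intro V _ G v H C hH hC hN _ ih A hA
    by_cases hv : v ∈ A
    · have h₁ := card_le_card (hA.subtype_compl_subset hv hC)
      rw [card_subtype_compl_singleton, hN.2] at h₁
      have := card_erase_add_one hv
      omega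
    · have := ih _ (hH ▸ hA.subtype_compl (v := v))
      rwa [card_subtype_compl_singleton, erase_eq_of_notMem hv] at this

theorem finset_eq_univ_of_card_eq {V : Type*} [Fintype V] {C : Finset V}
    (h : #C = Fintype.card V) : C = univ := (Finset.card_eq_iff_eq_univ C).1 h

/-- A vertex of degree `|V| - 1` is adjacent to all other vertices. -/
theorem adj_of_card_le_degree {V : Type*} [Fintype V] {G : SimpleGraph V} {x y : V}
    (h : Fintype.card V - 1 ≤ G.degree x) (hxy : x ≠ y) : G.Adj x y := by
  by_contra hn
  have hsub : G.neighborFinset x ⊆ (univ.erase x).erase y := by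
    intro z hz
    rw [SimpleGraph.mem_neighborFinset] at hz
    simp only [mem_erase, mem_univ, and_true]
    exact ⟨fun h => hn (h ▸ hz), hz.ne'⟩
  have h₁ := card_le_card hsub
  rw [SimpleGraph.card_neighborFinset_eq_degree, card_erase_of_mem (by simp [hxy.symm]),
    card_erase_of_mem (mem_univ x), card_univ] at h₁
  have : 1 < Fintype.card V := Fintype.one_lt_card_iff.2 ⟨x, y, hxy⟩
  omega

theorem card_sub_one_le_degree {V : Type*} [Fintype V] {G : SimpleGraph V} {x : V}
    (h : ∀ y, x ≠ y → G.Adj x y) : Fintype.card V - 1 ≤ G.degree x := by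
  have hsub : univ.erase x ⊆ G.neighborFinset x := by
    intro z hz
    rw [SimpleGraph.mem_neighborFinset]
    exact h z (ne_of_mem_erase hz).symm
  have h₁ := card_le_card hsub
  rwa [SimpleGraph.card_neighborFinset_eq_degree, card_erase_of_mem (mem_univ x), card_univ]
    at h₁

/-- A `k`-tree on `k + 1 + m` vertices has at most `2 m` vertices that are not adjacent to all
others. -/
theorem IsKTree.card_nonuniversal_le {k : ℕ} {V : Type u} [Fintype V] {G : SimpleGraph V}
    (hG : IsKTree k G) :
    #{x : V | G.degree x < Fintype.card V - 1} ≤ 2 * (Fintype.card V - (k + 1)) := by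
  refine hG.induct (motive := fun {V} _ G =>
    #{x : V | G.degree x < Fintype.card V - 1} ≤ 2 * (Fintype.card V - (k + 1))) ?_ ?_
  · intro V _ h
    rw [filter_eq_empty_iff.2]
    · simp
    · intro x _
      rw [not_lt]
      exact card_sub_one_le_degree fun y hy => hy
  · intro V _ G v H C hH hC hN hG ih
    have hcard := card_eq_card_compl_singleton_add_one v
    have hk := hG.le_card
    -- If the smaller tree is `K_k`, the truncated bound stays `0`, but then `G` is complete.
    -- Afterwards each step allows two new non-universal vertices: `v` and one more.
    obtain hk | hk := hk.eq_or_lt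
    · have hCu : C = univ := finset_eq_univ_of_card_eq (hN.2.trans hk)
      have hvx : ∀ y, v ≠ y → G.Adj v y := fun y hy =>
        (hC ⟨y, hy.symm⟩).1 (hCu ▸ mem_univ _)
      have : ∀ x : V, ¬ G.degree x < Fintype.card V - 1 := by
        intro x
        rw [not_lt]
        apply card_sub_one_le_degree
        intro y hxy
        by_cases hx : x = v
        · subst hx; exact hvx y hxy
        by_cases hy : y = v
        · subst hy; exact (hvx x hxy.symm).symm
        have h := hN.1 (x := ⟨x, hx⟩) (by rw [hCu]; simp) (y := ⟨y, hy⟩) (by rw [hCu]; simp)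
          (fun h => hxy (congrArg Subtype.val h))
        rw [hH] at h
        exact h
      simp [this]
    · -- at most one universal vertex of the smaller graph is not adjacent to `v`
      set B : Finset ({v}ᶜ : Set V) :=
        {x | ¬ H.degree x < Fintype.card ({v}ᶜ : Set V) - 1 ∧ x ∉ C}
      have hB : #B ≤ 1 := by
        -- Vertices of `B` are universal in `H`, so they extend the `k`-clique `C`, and cliques have
        -- at most `k + 1` vertices.
        have hcl : H.IsClique (C ∪ B : Finset _) := by
          intro x hx y hy hxy
          rw [Finset.mem_coe, mem_union] at hx hy
          rcases hx with hx | hx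
          · rcases hy with hy | hy
            · exact hN.1 hx hy hxy
            · exact (adj_of_card_le_degree (not_lt.1 (mem_filter.1 hy).2.1) hxy.symm).symm
          · exact adj_of_card_le_degree (not_lt.1 (mem_filter.1 hx).2.1) hxy
        have h₁ := hG.card_clique_le _ hcl
        rw [card_union_of_disjoint, hN.2] at h₁
        · omega
        · rw [disjoint_right]
          exact fun x hx => (mem_filter.1 hx).2.2
      have hsub : ({x : V | G.degree x < Fintype.card V - 1} : Finset V) ⊆
          insert v ((({x : ({v}ᶜ : Set V) | H.degree x < Fintype.card ({v}ᶜ : Set V) - 1} :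
            Finset _) ∪ B).map (Function.Embedding.subtype _)) := by
        intro x hx
        rw [mem_filter] at hx
        by_cases hxv : x = v
        · simp [hxv]
        refine mem_insert_of_mem (mem_map.2 ⟨⟨x, hxv⟩, ?_, rfl⟩)
        rw [mem_union, mem_filter, mem_filter]
        by_cases h : H.degree ⟨x, hxv⟩ < Fintype.card ({v}ᶜ : Set V) - 1
        · exact Or.inl ⟨mem_univ _, h⟩
        · refine Or.inr ⟨mem_univ _, h, fun hxC => ?_⟩
          have h₁ : G.degree x = _ := degree_eq_degree_induce_compl G v hH ⟨x, hxv⟩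
          rw [if_pos ((hC _).1 hxC)] at h₁
          have h₂ := hx.2
          omega
      have h₁ := card_le_card hsub
      have h₂ := card_insert_le v ((({x : ({v}ᶜ : Set V) | H.degree x <
        Fintype.card ({v}ᶜ : Set V) - 1} : Finset _) ∪ B).map (Function.Embedding.subtype _))
      rw [card_map] at h₂
      have h₃ := card_union_le ({x : ({v}ᶜ : Set V) | H.degree x <
        Fintype.card ({v}ᶜ : Set V) - 1} : Finset _) B
      omega

/-! ### Degrees inside a `k`-clique. -/

/-- The degrees of the vertices of a `k`-clique `C` of a `k`-tree on `n` vertices dominate the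
sequence `min (k + i) (n - 1)`, `i < k`. -/
theorem IsKTree.card_filter_degree_lt_le {k : ℕ} {V : Type u} [Fintype V] {G : SimpleGraph V}
    (hG : IsKTree k G) : ∀ C : Finset V, G.IsNClique k C → ∀ i : ℕ,
      #{x ∈ C | G.degree x < min (k + i) (Fintype.card V - 1)} ≤ i := by
  refine hG.induct (motive := fun {V} _ G => IsKTree k G → ∀ C : Finset V, G.IsNClique k C →
    ∀ i : ℕ, #{x ∈ C | G.degree x < min (k + i) (Fintype.card V - 1)} ≤ i) ?_ ?_ hG
  · intro V _ _ _ C _ i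
    rw [filter_eq_empty_iff.2]
    · simp
    · intro x _
      have := card_sub_one_le_degree (G := (⊤ : SimpleGraph V)) (x := x) fun y hy => hy
      omega
  · intro V _ G v H D hH hD hN hHT ih hGT C hC i
    replace ih := ih hHT
    have hcard := card_eq_card_compl_singleton_add_one v
    have hk := hHT.le_card
    by_cases hi : Fintype.card V - 1 ≤ k + i
    · rw [min_eq_right hi]
      -- With `n = |V|`: adding all universal vertices to `C` leaves it a clique, so `|C ∩ A| + n -
      -- |A| ≤ k + 1`. As `|A| ≤ 2 (n - k - 1)`, this gives `|C ∩ A| ≤ n - k - 1 ≤ i`.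
      set A : Finset V := {x : V | G.degree x < Fintype.card V - 1}
      have hA : #A ≤ 2 * (Fintype.card V - (k + 1)) := hGT.card_nonuniversal_le
      have hcl : G.IsClique (C ∪ Aᶜ : Finset V) := by
        intro x hx y hy hxy
        rw [Finset.mem_coe, mem_union, mem_compl, mem_filter] at hx hy
        by_cases hx' : G.degree x < Fintype.card V - 1
        · by_cases hy' : G.degree y < Fintype.card V - 1
          · exact hC.1 (by simpa [hx'] using hx) (by simpa [hy'] using hy) hxy
          · exact (adj_of_card_le_degree (not_lt.1 hy') hxy.symm).symm
        · exact adj_of_card_le_degree (not_lt.1 hx') hxy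
      have h₁ := hGT.card_clique_le _ hcl
      have h₂ : C ∪ Aᶜ = C.filter (· ∈ A) ∪ Aᶜ := by
        ext x
        simp only [mem_union, mem_filter, mem_compl]
        tauto
      rw [h₂, card_union_of_disjoint, card_compl] at h₁
      · have h₃ : C.filter (fun x => G.degree x < Fintype.card V - 1) = C.filter (· ∈ A) := by
          ext x
          simp [A]
        rw [h₃]
        have := A.card_le_univ
        omega
      · rw [disjoint_left]
        intro x hx
        simpa using (mem_filter.1 hx).2
    · have hmin : min (k + i) (Fintype.card V - 1) = k + i := by omega
      have hdeg := degree_eq_degree_induce_compl G v hH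
      rw [hmin]
      -- If `v ∈ C`, the other vertices of `C` lie in `D` and gain one degree from `v`. The
      -- threshold `k + i + 1` in `G` thus becomes `k + i` in `H`, and `v` accounts for the one
      -- extra vertex allowed.
      by_cases hv : v ∈ C
      · have hsub := hC.1.subtype_compl_subset hv hD
        have hCD : ∀ x (hx : x ∈ C) (hxv : x ≠ v),
            ⟨x, hxv⟩ ∈ D ∧ G.degree x = H.degree ⟨x, hxv⟩ + 1 := by
          intro x hx hxv
          have h : (⟨x, hxv⟩ : ({v}ᶜ : Set V)) ∈ D := hsub (by rwa [mem_subtype])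
          have h₁ : G.degree x = _ := hdeg ⟨x, hxv⟩
          rw [if_pos ((hD _).1 h)] at h₁
          exact ⟨h, h₁⟩
        have hdv : G.degree v = k := (degree_eq_card_compl G v D hD).trans hN.2
        obtain _ | i := i
        · have h₀ := ih D hN 0
          have hmin' : min (k + 0) (Fintype.card ({v}ᶜ : Set V) - 1) = k := by omega
          rw [hmin', Nat.le_zero, card_eq_zero, filter_eq_empty_iff] at h₀
          rw [Nat.le_zero, card_eq_zero, filter_eq_empty_iff]
          intro x hx
          by_cases hxv : x = v
          · subst hxv
            omega
          · have h₁ := hCD x hx hxv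
            have := h₀ h₁.1
            omega
        · have h₀ := ih D hN i
          have hmin' : min (k + i) (Fintype.card ({v}ᶜ : Set V) - 1) = k + i := by omega
          rw [hmin'] at h₀
          refine (card_le_card (t := insert v
            ((D.filter (fun x => H.degree x < k + i)).map (Function.Embedding.subtype _))) ?_).trans
            ((card_insert_le _ _).trans ?_)
          · intro x hx
            rw [mem_filter] at hx
            by_cases hxv : x = v
            · simp [hxv]
            · have h₁ := hCD x hx.1 hxv
              refine mem_insert_of_mem (mem_map.2 ⟨⟨x, hxv⟩, mem_filter.2 ⟨h₁.1, ?_⟩, rfl⟩)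
              omega
          · rw [card_map]
            omega
      · have hcl : H.IsNClique k (C.subtype (· ∈ ({v}ᶜ : Set V))) := by
          refine ⟨hH ▸ hC.1.subtype_compl, ?_⟩
          rw [card_subtype_compl_singleton, erase_eq_of_notMem hv, hC.2]
        have h₀ := ih _ hcl i
        have hmin' : min (k + i) (Fintype.card ({v}ᶜ : Set V) - 1) = k + i := by omega
        rw [hmin'] at h₀
        refine (card_le_card (t := ((C.subtype (· ∈ ({v}ᶜ : Set V))).filter
          (fun x => H.degree x < k + i)).map (Function.Embedding.subtype _)) ?_).trans ?_
        · intro x hx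
          rw [mem_filter] at hx
          have hxv : x ≠ v := fun h => hv (h ▸ hx.1)
          have h₁ : G.degree x = _ := hdeg ⟨x, hxv⟩
          refine mem_map.2 ⟨⟨x, hxv⟩, mem_filter.2 ⟨mem_subtype.2 hx.1, ?_⟩, rfl⟩
          omega
        · rwa [card_map]

/-- If `d` dominates the sequence `a` on `C`, then its sum along an increasing function is at
least that of `a`, and equality forces the values of `d` to be the terms of `a`. -/
theorem sum_range_le_sum_of_card_filter_lt_le {ι : Type*} {g : ℕ → ℝ} (hg : StrictMono g)
    (d : ι → ℕ) (a : ℕ → ℕ) (C : Finset ι) (h : ∀ i, #{x ∈ C | d x < a i} ≤ i) :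
    ∑ i ∈ range #C, g (a i) ≤ ∑ x ∈ C, g (d x) ∧
      (∑ i ∈ range #C, g (a i) = ∑ x ∈ C, g (d x) →
        C.val.map d = (Multiset.range #C).map a) := by
  generalize hn : #C = n
  induction n generalizing C with
  | zero => simp [card_eq_zero.1 hn]
  | succ n ih =>
    obtain ⟨c, hc, hmax⟩ := C.exists_max_image d (card_pos.1 (by omega))
    -- Otherwise all `n + 1` elements of `C` would have values below `a n`, while at most `n` may.
    have hle : a n ≤ d c := by
      by_contra! hlt
      have h₁ := h n
      rw [filter_true_of_mem (fun x hx => (hmax x hx).trans_lt hlt)] at h₁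
      omega
    obtain ⟨h₁, h₂⟩ := ih (C.erase c)
      (fun i => (card_le_card (filter_subset_filter _ (erase_subset c C))).trans (h i))
      (by rw [card_erase_of_mem hc, hn, Nat.add_sub_cancel])
    have hgle := hg.monotone hle
    rw [sum_range_succ, ← add_sum_erase C (fun x => g (d x)) hc]
    refine ⟨by linarith, fun heq => ?_⟩
    have h₃ := h₂ (by linarith)
    have h₄ : a n = d c := hg.injective (by linarith)
    rw [← insert_erase hc, insert_val_of_notMem (notMem_erase c C), Multiset.map_cons, h₃,
      Multiset.range_succ, Multiset.map_cons, h₄]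

/-! ### Degree sums and the upper bound. -/

/-- The sum of `h (deg v)` over all vertices `v`. -/
noncomputable def degSum (h : ℕ → ℝ) {V : Type*} [Fintype V] (G : SimpleGraph V) : ℝ :=
  ∑ v, h (G.degree v)

/-- The recursion behind both bounds: `v` contributes `h #C`, and the degree of each of its
neighbours rises by one. -/
theorem degSum_eq_degSum_add {V : Type*} [Fintype V] (h : ℕ → ℝ) {G : SimpleGraph V} {v : V}
    {H : SimpleGraph ({v}ᶜ : Set V)} (hH : H = G.induce ({v}ᶜ : Set V))
    {C : Finset ({v}ᶜ : Set V)} (hC : ∀ x, x ∈ C ↔ G.Adj v x) :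
    degSum h G = degSum h H + h #C + ∑ x ∈ C, (h (H.degree x + 1) - h (H.degree x)) := by
  have h₁ : ∀ x : ({v}ᶜ : Set V), h (G.degree x) =
      h (H.degree x) + if x ∈ C then h (H.degree x + 1) - h (H.degree x) else 0 := by
    intro x
    rw [degree_eq_degree_induce_compl G v hH x]
    by_cases hx : x ∈ C
    · rw [if_pos hx, if_pos ((hC x).1 hx)]
      ring
    · rw [if_neg hx, if_neg (fun h => hx ((hC x).2 h))]
      simp
  rw [degSum, sum_eq_add_sum_compl_singleton v, degree_eq_card_compl G v C hC,
    sum_congr rfl (fun x _ => h₁ x), sum_add_distrib, sum_ite_mem, univ_inter, degSum]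
  ring

theorem degSum_congr {V W : Type*} [Fintype V] [Fintype W] (h : ℕ → ℝ) {G : SimpleGraph V}
    {H : SimpleGraph W} (e : G ≃g H) : degSum h G = degSum h H := by
  refine Fintype.sum_equiv e.toEquiv _ _ fun v => ?_
  congr 1
  exact (e.degree_eq v).symm

/-- The value of `degSum` on the `k`-star with `n` vertices. -/
noncomputable def starSum (h : ℕ → ℝ) (k n : ℕ) : ℝ := k * h (n - 1) + ((n : ℝ) - k) * h k

/-- `G` consists of a `k`-clique joined to an independent set. -/
def IsStarLike (k : ℕ) {V : Type*} (G : SimpleGraph V) : Prop :=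
  ∃ U : Finset V, #U = k ∧ ∀ x y, G.Adj x y ↔ x ≠ y ∧ (x ∈ U ∨ y ∈ U)

theorem IsStarLike.degSum_eq {k : ℕ} {V : Type*} [Fintype V] {G : SimpleGraph V}
    (hG : IsStarLike k G) (h : ℕ → ℝ) : degSum h G = starSum h k (Fintype.card V) := by
  obtain ⟨U, hU, hadj⟩ := hG
  have h₁ : ∀ x ∈ U, h (G.degree x) = h (Fintype.card V - 1) := fun x hx => by
    congr 1
    refine le_antisymm ?_ (card_sub_one_le_degree fun y hy => (hadj x y).2 ⟨hy, Or.inl hx⟩)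
    have := G.degree_lt_card_verts x
    omega
  have h₂ : ∀ x ∈ Uᶜ, h (G.degree x) = h k := fun x hx => by
    rw [mem_compl] at hx
    congr 1
    rw [← SimpleGraph.card_neighborFinset_eq_degree, ← hU]
    congr 1
    ext y
    rw [SimpleGraph.mem_neighborFinset, hadj]
    constructor
    · rintro ⟨-, h | h⟩
      · exact absurd h hx
      · exact h
    · exact fun h => ⟨fun h' => hx (h' ▸ h), Or.inr h⟩
  rw [degSum, ← sum_add_sum_compl U, sum_congr rfl h₁, sum_congr rfl h₂, starSum]
  have h₃ := card_add_card_compl U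
  rw [hU] at h₃
  have h₄ : (#Uᶜ : ℝ) = (Fintype.card V : ℝ) - k := by
    rw [← h₃]
    push_cast
    ring
  simp [hU, h₄]

/-- Each increment is largest when the neighbour of `v` is universal in `H`. Equality in the last
step alone determines `G`, so the equality case of the induction hypothesis is not needed. -/
theorem IsKTree.degSum_le_starSum {k : ℕ} {h : ℕ → ℝ} (hh : StrictMono fun d => h (d + 1) - h d)
    {V : Type u} [Fintype V] {G : SimpleGraph V} (hG : IsKTree k G) :
    degSum h G ≤ starSum h k (Fintype.card V) ∧
      (degSum h G = starSum h k (Fintype.card V) → IsStarLike k G) := by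
  refine hG.induct (motive := fun {V} _ G => IsKTree k G →
    degSum h G ≤ starSum h k (Fintype.card V) ∧
      (degSum h G = starSum h k (Fintype.card V) → IsStarLike k G)) ?_ ?_ hG
  · intro V _ hV _
    have hs : IsStarLike k (⊤ : SimpleGraph V) :=
      ⟨univ, by rw [card_univ, hV], fun x y => by simp⟩
    exact ⟨(hs.degSum_eq h).le, fun _ => hs⟩
  · intro V _ G v H C hH hC hN hHT ih hGT
    replace ih := (ih hHT).1
    have hcard := card_eq_card_compl_singleton_add_one v
    set m := Fintype.card ({v}ᶜ : Set V) with hm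
    have hsum := degSum_eq_degSum_add h hH hC
    rw [hN.2] at hsum
    have hle : ∀ x ∈ C, h (H.degree x + 1) - h (H.degree x) ≤ h (m - 1 + 1) - h (m - 1) := by
      intro x _
      have := H.degree_lt_card_verts x
      exact hh.monotone (show H.degree x ≤ m - 1 by omega)
    have hstar : starSum h k (Fintype.card V) =
        starSum h k m + h k + ∑ x ∈ C, (h (m - 1 + 1) - h (m - 1)) := by
      rw [sum_const, hN.2, nsmul_eq_mul, starSum, starSum, hcard]
      push_cast
      -- `m - 1 + 1` differs from `m` only if `m = 0`, which forces `k = 0`; the affected terms then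
      -- vanish.
      obtain hk | hk := Nat.eq_zero_or_pos k
      · simp [hk]
        ring
      · have := hHT.le_card
        rw [Nat.sub_add_cancel (by omega)]
        ring
    refine ⟨by rw [hsum, hstar]; linarith [sum_le_sum hle], fun heq => ?_⟩
    have huniv : ∀ x ∈ C, m - 1 ≤ H.degree x := by
      have h₁ : ∑ x ∈ C, (h (H.degree x + 1) - h (H.degree x)) =
          ∑ x ∈ C, (h (m - 1 + 1) - h (m - 1)) :=
        le_antisymm (sum_le_sum hle) (by linarith)
      intro x hx
      exact (hh.injective ((sum_eq_sum_iff_of_le hle).1 h₁ x hx)).ge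
    have hCadj : ∀ x ∈ C, ∀ y, (x : V) ≠ y → G.Adj x y := by
      intro x hx y hy
      by_cases hyv : y = v
      · subst hyv
        exact ((hC x).1 hx).symm
      · have h₁ := adj_of_card_le_degree (y := ⟨y, hyv⟩) (huniv x hx)
          (fun h => hy (congrArg Subtype.val h))
        rw [hH] at h₁
        exact h₁
    have hmem : ∀ x, x ∈ C.map (Function.Embedding.subtype _) → ∀ y, x ≠ y → G.Adj x y := by
      intro x hx
      obtain ⟨z, hz, rfl⟩ := mem_map.1 hx
      exact hCadj z hz
    refine ⟨C.map (Function.Embedding.subtype _), by rw [card_map, hN.2], fun x y => ⟨?_, ?_⟩⟩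
    · intro hxy
      refine ⟨hxy.ne, ?_⟩
      by_contra! hout
      have hcl : G.IsClique
          (insert x (insert y (C.map (Function.Embedding.subtype _))) : Finset V) := by
        intro a ha b hb hab
        rw [Finset.mem_coe, mem_insert, mem_insert] at ha hb
        rcases ha with rfl | rfl | ha
        · rcases hb with rfl | rfl | hb
          · exact absurd rfl hab
          · exact hxy
          · exact (hmem b hb a hab.symm).symm
        · rcases hb with rfl | rfl | hb
          · exact hxy.symm
          · exact absurd rfl hab
          · exact (hmem b hb a hab.symm).symm
        · exact hmem a ha b hab
      have h₁ := hGT.card_clique_le _ hcl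
      rw [card_insert_of_notMem, card_insert_of_notMem hout.2, card_map, hN.2] at h₁
      · omega
      · rw [mem_insert, not_or]
        exact ⟨hxy.ne, hout.1⟩
    · rintro ⟨hxy, hx | hy⟩
      · exact hmem x hx y hxy
      · exact (hmem y hy x hxy.symm).symm

/-! ### Labellings of `k`-paths. -/

/-- A numbering of the vertices by `0, …, |V| - 1` that shows `G` to be a `k`-path. -/
structure IsPathLabelling (k : ℕ) {V : Type*} [Fintype V] (G : SimpleGraph V) (f : V → ℕ) :
    Prop where
  inj : Function.Injective f
  lt_card : ∀ x, f x < Fintype.card V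
  adj_iff : ∀ x y, G.Adj x y ↔ x ≠ y ∧ f x ≤ f y + k ∧ f y ≤ f x + k

namespace IsPathLabelling

variable {k : ℕ} {V : Type*} [Fintype V] {G : SimpleGraph V} {f : V → ℕ}

theorem image_eq (hf : IsPathLabelling k G f) : univ.image f = range (Fintype.card V) := by
  refine eq_of_subset_of_card_le (fun i hi => ?_) ?_
  · obtain ⟨x, -, rfl⟩ := mem_image.1 hi
    exact mem_range.2 (hf.lt_card x)
  · rw [card_image_of_injective _ hf.inj, card_univ, card_range]

theorem exists_eq (hf : IsPathLabelling k G f) {i : ℕ} (hi : i < Fintype.card V) :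
    ∃ x, f x = i := by
  have := hf.image_eq ▸ mem_range.2 hi
  simpa using this

/-- Reindexing a sum over the last vertices by the distance from the end. -/
theorem sum_filter_eq (hf : IsPathLabelling k G f) {M : Type*} [AddCommMonoid M] {m : ℕ}
    (hm : m ≤ Fintype.card V) (F : ℕ → M) :
    ∑ x with Fintype.card V ≤ f x + m, F (Fintype.card V - 1 - f x) = ∑ j ∈ range m, F j := by
  refine sum_bij (fun x _ => Fintype.card V - 1 - f x) ?_ ?_ ?_ (fun _ _ => rfl)
  · intro x hx
    have := hf.lt_card x
    have := (mem_filter.1 hx).2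
    rw [mem_range]
    omega
  · intro x _ y _ hxy
    have := hf.lt_card x
    have := hf.lt_card y
    exact hf.inj (by omega)
  · intro j hj
    rw [mem_range] at hj
    obtain ⟨x, hx⟩ := hf.exists_eq (show Fintype.card V - 1 - j < Fintype.card V by omega)
    refine ⟨x, mem_filter.2 ⟨mem_univ _, ?_⟩, ?_⟩ <;> omega

theorem degree_eq (hf : IsPathLabelling k G f) (x : V) :
    G.degree x = min (f x) k + min (Fintype.card V - 1 - f x) k := by
  have h₁ : (G.neighborFinset x).image f =
      Ico (f x - k) (f x) ∪ Ico (f x + 1) (min (Fintype.card V) (f x + k + 1)) := by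
    ext i
    simp only [mem_image, SimpleGraph.mem_neighborFinset, hf.adj_iff, mem_union, mem_Ico]
    constructor
    · rintro ⟨y, ⟨hxy, h⟩, rfl⟩
      have h₂ : f x ≠ f y := fun h => hxy (hf.inj h)
      have := hf.lt_card y
      omega
    · intro h
      have := hf.lt_card x
      obtain ⟨y, hy⟩ := hf.exists_eq (show i < Fintype.card V by omega)
      refine ⟨y, ⟨fun h => ?_, ?_⟩, hy⟩
      · subst h
        omega
      · omega
  rw [← SimpleGraph.card_neighborFinset_eq_degree, ← card_image_of_injective _ hf.inj, h₁,
    card_union_of_disjoint, Nat.card_Ico, Nat.card_Ico]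
  · have := hf.lt_card x
    omega
  · rw [disjoint_left]
    intro i hi
    rw [mem_Ico] at hi ⊢
    omega

theorem reflect (hf : IsPathLabelling k G f) :
    IsPathLabelling k G (fun x => Fintype.card V - 1 - f x) where
  inj x y hxy := by
    have := hf.lt_card x
    have := hf.lt_card y
    exact hf.inj (by simp only at hxy; omega)
  lt_card x := by
    have := hf.lt_card x
    omega
  adj_iff x y := by
    have := hf.lt_card x
    have := hf.lt_card y
    rw [hf.adj_iff]
    refine and_congr_right fun _ => ?_
    omega

/-- Exchanging the labels of two vertices that are adjacent to all others. -/
theorem swap (hf : IsPathLabelling k G f) {q r : V}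
    (hq : f q ≤ k ∧ Fintype.card V ≤ f q + k + 1)
    (hr : f r ≤ k ∧ Fintype.card V ≤ f r + k + 1) :
    IsPathLabelling k G (fun x => f (Equiv.swap q r x)) where
  inj := hf.inj.comp (Equiv.swap q r).injective
  lt_card x := hf.lt_card _
  adj_iff x y := by
    rw [hf.adj_iff]
    refine and_congr_right fun _ => ?_
    have hx := hf.lt_card x
    have hy := hf.lt_card y
    have hq' := hf.lt_card q
    have hr' := hf.lt_card r
    simp only [Equiv.swap_apply_def]
    split_ifs <;> subst_vars <;> omega

theorem nonempty_iso {n : ℕ} (hf : IsPathLabelling k G f) (hn : Fintype.card V = n) :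
    Nonempty (G ≃g kPath k n) := by
  subst hn
  have hinj : Function.Injective (fun x => (⟨f x, hf.lt_card x⟩ : Fin (Fintype.card V))) :=
    fun x y hxy => hf.inj (congrArg Fin.val hxy)
  have hbij := (Fintype.bijective_iff_injective_and_card _).2 ⟨hinj, by simp⟩
  refine ⟨⟨Equiv.ofBijective _ hbij, fun {x y} => ?_⟩⟩
  rw [hf.adj_iff]
  refine and_congr_left fun _ => ?_
  exact not_congr hinj.eq_iff

/-- Appending a vertex whose neighbourhood consists of the last `k` vertices. -/
theorem append {v : V} {H : SimpleGraph ({v}ᶜ : Set V)} (hH : H = G.induce ({v}ᶜ : Set V))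
    {g : ({v}ᶜ : Set V) → ℕ} (hg : IsPathLabelling k H g)
    (hv : ∀ x : ({v}ᶜ : Set V), G.Adj v x ↔ Fintype.card ({v}ᶜ : Set V) ≤ g x + k) :
    IsPathLabelling k G
      (fun x => if hx : x = v then Fintype.card ({v}ᶜ : Set V) else g ⟨x, hx⟩) where
  inj x y hxy := by
    simp only at hxy
    split_ifs at hxy with hx hy hy
    · rw [hx, hy]
    · exact absurd hxy (hg.lt_card _).ne'
    · exact absurd hxy (hg.lt_card _).ne
    · exact congrArg Subtype.val (hg.inj hxy)
  lt_card x := by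
    rw [card_eq_card_compl_singleton_add_one v]
    split_ifs with hx
    · omega
    · have := hg.lt_card ⟨x, hx⟩
      omega
  adj_iff x y := by
    have hvx : ∀ x (hx : x ≠ v), G.Adj v x ↔ Fintype.card ({v}ᶜ : Set V) ≤ g ⟨x, hx⟩ + k :=
      fun x hx => hv ⟨x, hx⟩
    by_cases hx : x = v
    · by_cases hy : y = v
      · simp [hx, hy]
      · have := hg.lt_card ⟨y, hy⟩
        rw [dif_pos hx, dif_neg hy, hx, hvx y hy]
        have : v ≠ y := fun h => hy h.symm
        simp only [ne_eq, this, not_false_eq_true, true_and]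
        omega
    · have := hg.lt_card ⟨x, hx⟩
      rw [dif_neg hx]
      by_cases hy : y = v
      · rw [dif_pos hy, hy, G.adj_comm, hvx x hx]
        simp only [ne_eq, hx, not_false_eq_true, true_and]
        omega
      · rw [dif_neg hy]
        have h := hg.adj_iff ⟨x, hx⟩ ⟨y, hy⟩
        rw [hH] at h
        refine h.trans (and_congr_left fun _ => ?_)
        exact not_congr Subtype.mk_eq_mk

/-- Deleting the last vertex. -/
theorem delete (hf : IsPathLabelling k G f) {v : V} (hv : f v + 1 = Fintype.card V)
    {H : SimpleGraph ({v}ᶜ : Set V)} (hH : H = G.induce ({v}ᶜ : Set V)) :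
    IsPathLabelling k H (fun x => f x) where
  inj x y hxy := Subtype.ext (hf.inj hxy)
  lt_card x := by
    have h₁ := hf.lt_card x
    have h₂ : f x ≠ f v := fun h => x.2 (hf.inj h)
    have := card_eq_card_compl_singleton_add_one v
    omega
  adj_iff x y := by
    rw [hH, SimpleGraph.comap_adj, hf.adj_iff]
    simp [Subtype.ext_iff]

end IsPathLabelling

/-! ### The lower bound. -/

/-- The value of `degSum` on the `k`-path with `k + m` vertices. -/
noncomputable def pathSum (h : ℕ → ℝ) (k : ℕ) : ℕ → ℝ
  | 0 => k * h (k - 1)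
  | m + 1 => pathSum h k m + h k +
      ∑ j ∈ range k, (h (min (k + j) (k + m - 1) + 1) - h (min (k + j) (k + m - 1)))

/-- Once the last vertex is deleted, a former neighbour at distance `j` from the new end has degree
`min (k + j) (k + m - 1)`, which is the term in the recursion of `pathSum`. -/
theorem IsPathLabelling.degSum_eq {k m : ℕ} (h : ℕ → ℝ) {V : Type u} [Fintype V]
    {G : SimpleGraph V} {f : V → ℕ} (hf : IsPathLabelling k G f)
    (hm : Fintype.card V = k + m) : degSum h G = pathSum h k m := by
  induction m generalizing V with
  | zero =>
    have h₁ : ∀ x, G.degree x = k - 1 := fun x => by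
      rw [hf.degree_eq]
      have := hf.lt_card x
      omega
    simp [degSum, h₁, hm, pathSum]
  | succ m ih =>
    obtain ⟨v, hv⟩ := hf.exists_eq (show k + m < Fintype.card V by omega)
    obtain ⟨H, hH⟩ : ∃ H, H = G.induce ({v}ᶜ : Set V) := ⟨_, rfl⟩
    have hcard := card_eq_card_compl_singleton_add_one v
    have hg := hf.delete (by omega) hH
    have hC : ∀ x, x ∈ ({x | Fintype.card ({v}ᶜ : Set V) ≤ f x + k} :
        Finset ({v}ᶜ : Set V)) ↔ G.Adj v x := by
      intro x
      have h₁ := hf.lt_card x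
      have h₂ : v ≠ x := fun h => x.2 h.symm
      rw [mem_filter, hf.adj_iff]
      simp only [mem_univ, true_and, ne_eq, h₂, not_false_eq_true]
      omega
    have hdeg : ∀ x : ({v}ᶜ : Set V), Fintype.card ({v}ᶜ : Set V) ≤ f x + k →
        H.degree x = min (k + (Fintype.card ({v}ᶜ : Set V) - 1 - f x)) (k + m - 1) := by
      intro x hx
      rw [hg.degree_eq]
      have := hg.lt_card x
      omega
    have hcardC : #({x | Fintype.card ({v}ᶜ : Set V) ≤ f x + k} :
        Finset ({v}ᶜ : Set V)) = k := by
      have h₁ := hg.sum_filter_eq (m := k) (by omega) (fun _ => 1)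
      simpa using h₁
    rw [degSum_eq_degSum_add h hH hC, ih hg (by omega), hcardC, pathSum,
      ← hg.sum_filter_eq (m := k) (by omega)]
    congr 1
    refine sum_congr rfl fun x hx => ?_
    rw [hdeg x (mem_filter.1 hx).2]

/-- If the last vertex of a `k`-tree is joined to a clique of a `k`-path with the degrees of an
end clique, then the `k`-path has a labelling in which this clique is the end clique. -/
theorem IsPathLabelling.exists_end {k : ℕ} (hk : 1 ≤ k) {V : Type*} [Fintype V]
    {G : SimpleGraph V} {f : V → ℕ} (hf : IsPathLabelling k G f) {C : Finset V}
    (hC : G.IsNClique k C)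
    (hdeg : C.val.map (fun x => G.degree x) =
      (Multiset.range k).map (fun i => min (k + i) (Fintype.card V - 1))) :
    ∃ g, IsPathLabelling k G g ∧ ∀ x, x ∈ C ↔ Fintype.card V ≤ g x + k := by
  have hkn : k ≤ Fintype.card V := hC.2 ▸ C.card_le_univ
  obtain hkn | hkn := hkn.eq_or_lt
  · refine ⟨f, hf, fun x => ?_⟩
    rw [finset_eq_univ_of_card_eq (hC.2.trans hkn)]
    simp only [mem_univ, true_iff]
    omega
  -- the clique is contained in the last `k + 1` vertices, after a reflection if necessary
  obtain ⟨g, hg, hgC⟩ : ∃ g, IsPathLabelling k G g ∧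
      ∀ x ∈ C, Fintype.card V ≤ g x + (k + 1) := by
    by_cases hsmall : Fintype.card V ≤ k + 1
    · exact ⟨f, hf, fun x _ => by omega⟩
    -- The term `i = 0` gives a vertex of `C` of degree `k`. With more than `k + 1` vertices only
    -- the two ends of the path have this degree, and `C` lies within distance `k` of such an end.
    have hmem : k ∈ (Multiset.range k).map (fun i => min (k + i) (Fintype.card V - 1)) :=
      Multiset.mem_map.2 ⟨0, Multiset.mem_range.2 hk, by omega⟩
    rw [← hdeg] at hmem
    obtain ⟨c, hc, hck⟩ := Multiset.mem_map.1 hmem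
    have hclose : ∀ x ∈ C, f c ≤ f x + k ∧ f x ≤ f c + k := by
      intro x hx
      by_cases hxc : c = x
      · subst hxc
        omega
      · exact ((hf.adj_iff c x).1 (hC.1 hc hx hxc)).2
    have hfc := hf.lt_card c
    rw [hf.degree_eq] at hck
    by_cases h0 : f c = 0
    · refine ⟨_, hf.reflect, fun x hx => ?_⟩
      have := hclose x hx
      have := hf.lt_card x
      omega
    · refine ⟨f, hf, fun x hx => ?_⟩
      have := hclose x hx
      omega
  set n := Fintype.card V with hn
  set Q : Finset V := {x | n ≤ g x + (k + 1)} with hQ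
  have hCQ : C ⊆ Q := fun x hx => mem_filter.2 ⟨mem_univ _, hgC x hx⟩
  have hQcard : #Q = k + 1 := by
    rw [card_eq_sum_ones, hQ, hn, hg.sum_filter_eq (m := k + 1) hkn (fun _ => 1)]
    simp
  obtain ⟨q, hqC, hqQ⟩ : ∃ q, q ∉ C ∧ insert q C = Q := by
    obtain ⟨q, hq⟩ := card_eq_one.1 (show #(Q \ C) = 1 by
      rw [card_sdiff_of_subset hCQ, hQcard, hC.2]
      omega)
    have hq' : q ∈ Q \ C := hq ▸ mem_singleton_self q
    refine ⟨q, (mem_sdiff.1 hq').2, ?_⟩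
    rw [insert_eq, ← hq, sdiff_union_of_subset hCQ]
  have hmemC : ∀ x, x ∈ C ↔ x ≠ q ∧ n ≤ g x + (k + 1) := by
    intro x
    have h₁ : x ∈ insert q C ↔ n ≤ g x + (k + 1) := by
      rw [hqQ]
      simp [hQ]
    rw [mem_insert] at h₁
    constructor
    · exact fun hx => ⟨fun h => hqC (h ▸ hx), h₁.1 (Or.inr hx)⟩
    · exact fun hx => (h₁.2 hx.2).resolve_left hx.1
  have hqn : n ≤ g q + (k + 1) := by
    have : q ∈ Q := hqQ ▸ mem_insert_self q C
    simpa [hQ] using this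
  have hgq := hg.lt_card q
  -- Compare the degree sums over the last `k + 1` vertices and over `C`.
  have hdq : G.degree q = min (k + k) (n - 1) := by
    have h₁ := hg.sum_filter_eq (m := k + 1) hkn (fun j => min (k + j) (n - 1))
    have h₂ : ∑ x with n ≤ g x + (k + 1), min (k + (n - 1 - g x)) (n - 1) =
        ∑ x ∈ Q, G.degree x := by
      refine sum_congr rfl fun x hx => ?_
      have := hg.lt_card x
      have := (mem_filter.1 hx).2
      rw [hg.degree_eq]
      omega
    have h₃ : ∑ x ∈ C, G.degree x = ∑ j ∈ range k, min (k + j) (n - 1) :=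
      congrArg Multiset.sum hdeg
    rw [← hn] at h₁
    rw [h₂, ← hqQ, sum_insert hqC, h₃, sum_range_succ] at h₁
    omega
  rw [hg.degree_eq] at hdq
  obtain ⟨r, hr⟩ := hg.exists_eq (show n - 1 - k < n by omega)
  -- `r` is the first of the last `k + 1` vertices, the one that should be missing from `C`. If `q ≠
  -- r`, fewer than `k` vertices follow `q`, so its degree must be `n - 1` with label at most `k`.
  -- Then `q` and `r` are both universal and can be exchanged.
  by_cases hqr : q = r
  · subst hqr
    refine ⟨g, hg, fun x => ?_⟩
    rw [hmemC]
    have h₁ : x ≠ q ↔ g x ≠ g q := hg.inj.ne_iff.symm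
    rw [h₁]
    omega
  · have hgqr : g q ≠ g r := fun h => hqr (hg.inj h)
    refine ⟨_, hg.swap (q := q) (r := r) (by omega) (by omega), fun x => ?_⟩
    have h₁ : x ≠ q ↔ g x ≠ g q := hg.inj.ne_iff.symm
    rw [hmemC, h₁]
    have h₂ : x ≠ r ↔ g x ≠ g r := hg.inj.ne_iff.symm
    simp only [Equiv.swap_apply_def]
    split_ifs with h₃ h₄
    · subst h₃
      omega
    · subst h₄
      omega
    · have := h₁.1 h₃
      have := h₂.1 h₄
      omega

/-- Domination of the degrees in `C` bounds the increment. Equality passes to `H` and fixes the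
degrees in `C`, so `exists_end` and `append` extend the labelling to `v`. -/
theorem IsKTree.pathSum_le_degSum {k : ℕ} (hk : 1 ≤ k) {h : ℕ → ℝ}
    (hh : StrictMono fun d => h (d + 1) - h d) {V : Type u} [Fintype V] {G : SimpleGraph V}
    (hG : IsKTree k G) : ∀ m, Fintype.card V = k + m → pathSum h k m ≤ degSum h G ∧
      (degSum h G = pathSum h k m → ∃ f, IsPathLabelling k G f) := by
  refine hG.induct (motive := fun {V} _ G => ∀ m, Fintype.card V = k + m →
    pathSum h k m ≤ degSum h G ∧
      (degSum h G = pathSum h k m → ∃ f, IsPathLabelling k G f)) ?_ ?_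
  · intro V _ hV m hm
    have hf : IsPathLabelling k (⊤ : SimpleGraph V) (fun x => (Fintype.equivFin V x : ℕ)) := by
      refine ⟨fun x y hxy => (Fintype.equivFin V).injective (Fin.ext hxy), fun x => Fin.is_lt _,
        fun x y => ?_⟩
      have := (Fintype.equivFin V x).is_lt
      have := (Fintype.equivFin V y).is_lt
      simp only [SimpleGraph.top_adj]
      refine (and_iff_left ?_).symm
      omega
    exact ⟨(hf.degSum_eq h hm).ge, fun _ => ⟨_, hf⟩⟩
  · intro V _ G v H C hH hC hN hHT ih m hm
    have hcard := card_eq_card_compl_singleton_add_one v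
    have hle := hHT.le_card
    obtain _ | m := m
    · omega
    have hm' : Fintype.card ({v}ᶜ : Set V) = k + m := by omega
    obtain ⟨ih₁, ih₂⟩ := ih m hm'
    obtain ⟨h₁, h₂⟩ := sum_range_le_sum_of_card_filter_lt_le hh (fun x => H.degree x)
      (fun i => min (k + i) (Fintype.card ({v}ᶜ : Set V) - 1)) C
      (fun i => hHT.card_filter_degree_lt_le C hN i)
    rw [hN.2] at h₁ h₂
    simp only [hm'] at h₁ h₂
    rw [degSum_eq_degSum_add h hH hC, hN.2, pathSum]
    refine ⟨by linarith, fun heq => ?_⟩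
    obtain ⟨f, hf⟩ := ih₂ (by linarith)
    obtain ⟨g, hg, hgC⟩ := hf.exists_end hk hN (by rw [hm']; exact h₂ (by linarith))
    exact ⟨_, hg.append hH fun x => (hC x).symm.trans (hgC x)⟩

end KTree

/-! ### Isomorphisms with the model graphs. -/

/-- A path labelling is transported along a graph isomorphism from the `k`-path itself. -/
theorem isPathLabelling_of_iso {k n : ℕ} {V : Type*} [Fintype V] {G : SimpleGraph V}
    (e : G ≃g kPath k n) : IsPathLabelling k G (fun x => (e x : ℕ)) where
  inj x y hxy := e.injective (Fin.ext hxy)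
  lt_card x := by
    have h := Fintype.card_congr e.toEquiv
    rw [Fintype.card_fin] at h
    rw [h]
    exact (e x).is_lt
  adj_iff x y := by
    rw [← e.map_adj_iff]
    exact and_congr_left fun _ => e.injective.ne_iff

theorem isStarLike_kStar {k n : ℕ} (hkn : k ≤ n) : IsStarLike k (kStar k n) := by
  refine ⟨univ.filter fun i => (i : ℕ) < k, ?_, fun x y => ?_⟩
  · rw [Fin.card_filter_val_lt, min_eq_right hkn]
  · simp [kStar]

/-- Any bijection taking `U` to the first `k` labels works: an arbitrary numbering is corrected by a
permutation of `Fin n`. -/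
theorem IsStarLike.nonempty_iso {k n : ℕ} {V : Type*} [Fintype V] {G : SimpleGraph V}
    (hG : IsStarLike k G) (hn : Fintype.card V = n) : Nonempty (G ≃g kStar k n) := by
  classical
  obtain ⟨U, hU, hadj⟩ := hG
  have hkn : k ≤ n := by
    rw [← hU, ← hn]
    exact U.card_le_univ
  let e := Fintype.equivFinOfCardEq hn
  let E : {i : Fin n // e.symm i ∈ U} ≃ {i : Fin n // (i : ℕ) < k} := Fintype.equivOfCardEq (by
    rw [Fintype.card_subtype, Fintype.card_subtype, Fin.card_filter_val_lt, min_eq_right hkn,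
      ← hU]
    refine (card_map e.toEmbedding).symm.trans ?_ |>.symm
    congr 1
    ext i
    simp [e])
  have hmem : ∀ x, ((E.extendSubtype (e x) : Fin n) : ℕ) < k ↔ x ∈ U := by
    intro x
    by_cases hx : x ∈ U
    · exact iff_of_true (E.extendSubtype_mem (e x) (by simpa using hx)) hx
    · exact iff_of_false (E.extendSubtype_not_mem (e x) (by simpa using hx)) hx
  refine ⟨⟨e.trans E.extendSubtype, fun {x y} => ?_⟩⟩
  rw [hadj]
  simp only [kStar, Equiv.trans_apply, hmem, ne_eq, EmbeddingLike.apply_eq_iff_eq]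

/-! ### The Zagreb index through logarithms. -/

/-- Strict convexity of `x log x` on `[0, ∞)`, read off as increasing slopes over consecutive unit
intervals. -/
theorem strictMono_mul_log_succ_sub :
    StrictMono fun d : ℕ => ((d + 1 : ℕ) : ℝ) * Real.log ((d + 1 : ℕ) : ℝ) - d * Real.log d := by
  refine strictMono_nat_of_lt_succ fun d => ?_
  have h := Real.strictConvexOn_mul_log.slope_strict_mono_adjacent (x := (d : ℝ))
    (y := ((d + 1 : ℕ) : ℝ)) (z := ((d + 1 + 1 : ℕ) : ℝ))
    (Set.mem_Ici.2 (Nat.cast_nonneg d)) (Set.mem_Ici.2 (Nat.cast_nonneg _))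
    (by push_cast; linarith) (by push_cast; linarith)
  have h₁ : ((d + 1 : ℕ) : ℝ) - d = 1 := by push_cast; ring
  have h₂ : ((d + 1 + 1 : ℕ) : ℝ) - (d + 1 : ℕ) = 1 := by push_cast; ring
  rwa [h₁, h₂, div_one, div_one] at h

/-- Take the product of source degrees over all darts: grouped by source it gives `d(v)^d(v)`,
grouped by edge it gives `d(u) d(v)`. -/
theorem secondZagreb_eq_prod_degree_pow {V : Type*} [Fintype V] [DecidableEq V]
    (G : SimpleGraph V) [DecidableRel G.Adj] :
    secondZagreb G = ∏ v, G.degree v ^ G.degree v := by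
  have h₁ : ∏ d : G.Dart, G.degree d.fst = ∏ v, G.degree v ^ G.degree v := by
    rw [← Finset.prod_fiberwise univ (fun d : G.Dart => d.fst)]
    refine prod_congr rfl fun v _ => ?_
    rw [prod_congr rfl (g := fun _ => G.degree v), prod_const, G.dart_fst_fiber_card_eq_degree]
    intro d hd
    rw [(mem_filter.1 hd).2]
  rw [← h₁, secondZagreb,
    ← Finset.prod_fiberwise_of_maps_to (s := univ) (t := G.edgeFinset)
      (g := fun d : G.Dart => d.edge) (fun d _ => SimpleGraph.mem_edgeFinset.2 d.edge_mem)]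
  refine prod_congr rfl fun e he => ?_
  induction e with
  | _ u v =>
  have hadj : G.Adj u v := SimpleGraph.mem_edgeFinset.1 he
  have h₂ := SimpleGraph.Dart.edge_fiber (⟨(u, v), hadj⟩ : G.Dart)
  have h₃ : (⟨(u, v), hadj⟩ : G.Dart).edge = s(u, v) := rfl
  rw [h₃] at h₂
  rw [h₂, prod_insert, prod_singleton]
  · rfl
  · rw [mem_singleton]
    exact (SimpleGraph.Dart.symm_ne _).symm

theorem secondZagreb_pos {V : Type*} [Fintype V] [DecidableEq V] (G : SimpleGraph V)
    [DecidableRel G.Adj] : 0 < secondZagreb G := by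
  rw [secondZagreb_eq_prod_degree_pow]
  refine prod_pos fun v _ => ?_
  obtain h | h := Nat.eq_zero_or_pos (G.degree v)
  · simp [h]
  · exact Nat.pow_pos h

theorem log_secondZagreb {V : Type*} [Fintype V] [DecidableEq V] (G : SimpleGraph V)
    [DecidableRel G.Adj] :
    Real.log (secondZagreb G) = degSum (fun d => (d : ℝ) * Real.log d) G := by
  have hne : ∀ v ∈ (univ : Finset V), ((G.degree v : ℝ) ^ G.degree v) ≠ 0 := by
    intro v _
    obtain h | h := Nat.eq_zero_or_pos (G.degree v)
    · simp [h]
    · positivity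
  rw [secondZagreb_eq_prod_degree_pow]
  push_cast
  rw [Real.log_prod hne, degSum]
  refine sum_congr rfl fun v _ => ?_
  rw [Real.log_pow]
  -- Only the decidability instances used to compute the degree differ.
  congr!

theorem theorem3 {V : Type*} [Fintype V] [DecidableEq V] (k n : ℕ) (hk : 1 ≤ k) (hkn : k ≤ n)
    (T : SimpleGraph V) [DecidableRel T.Adj] (hT : IsKTree k T) (hn : Fintype.card V = n) :
    secondZagreb T = ∏ v, T.degree v ^ T.degree v ∧
    secondZagreb (kPath k n) ≤ secondZagreb T ∧
    secondZagreb T ≤ secondZagreb (kStar k n) ∧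
    (secondZagreb T = secondZagreb (kPath k n) ↔ Nonempty (T ≃g kPath k n)) ∧
    (secondZagreb T = secondZagreb (kStar k n) ↔ Nonempty (T ≃g kStar k n)) := by
  obtain ⟨m, rfl⟩ := Nat.exists_eq_add_of_le hkn
  have hle : ∀ {a b : ℕ}, 0 < a → 0 < b → (Real.log a ≤ Real.log b ↔ a ≤ b) := by
    intro a b ha hb
    rw [Real.log_le_log_iff (Nat.cast_pos.2 ha) (Nat.cast_pos.2 hb), Nat.cast_le]
  have heq : ∀ {a b : ℕ}, 0 < a → 0 < b → (Real.log a = Real.log b ↔ a = b) := by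
    intro a b ha hb
    rw [le_antisymm_iff, hle ha hb, hle hb ha, ← le_antisymm_iff]
  have hT' := secondZagreb_pos T
  have hP' := secondZagreb_pos (kPath k (k + m))
  have hS' := secondZagreb_pos (kStar k (k + m))
  have hP := (isPathLabelling_of_iso (RelIso.refl (kPath k (k + m)).Adj)).degSum_eq
    (fun d => (d : ℝ) * Real.log d) (Fintype.card_fin _)
  have hS := (isStarLike_kStar hkn).degSum_eq (fun d => (d : ℝ) * Real.log d)
  rw [Fintype.card_fin] at hS
  obtain ⟨h₁, h₂⟩ := hT.pathSum_le_degSum hk (h := fun d => (d : ℝ) * Real.log d)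
    strictMono_mul_log_succ_sub m hn
  obtain ⟨h₃, h₄⟩ := hT.degSum_le_starSum (h := fun d => (d : ℝ) * Real.log d)
    strictMono_mul_log_succ_sub
  rw [hn] at h₃ h₄
  refine ⟨secondZagreb_eq_prod_degree_pow T, ?_, ?_, ⟨fun h => ?_, ?_⟩, ⟨fun h => ?_, ?_⟩⟩
  · rwa [← hle hP' hT', log_secondZagreb, log_secondZagreb, hP]
  · rwa [← hle hT' hS', log_secondZagreb, log_secondZagreb, hS]
  · rw [← heq hT' hP', log_secondZagreb, log_secondZagreb, hP] at h
    obtain ⟨f, hf⟩ := h₂ h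
    exact hf.nonempty_iso hn
  · rintro ⟨e⟩
    rw [← heq hT' hP', log_secondZagreb, log_secondZagreb, degSum_congr _ e]
  · rw [← heq hT' hS', log_secondZagreb, log_secondZagreb, hS] at h
    exact (h₄ h).nonempty_iso hn
  · rintro ⟨e⟩
    rw [← heq hT' hS', log_secondZagreb, log_secondZagreb, degSum_congr _ e]
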